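/- Let $\{|n\rangle\}_{n\ge 0}$ be the Fock basis of one bosonic mode and let $|i,j\rangle=|i\rangle\otimes|j\rangle$ be the product basis of two modes. For $\theta\in\mathbb R$ let $U(\theta)$ denote the beam splitter, whose action on an $n$-photon state with vacuum in the second port is $$U(\theta)|n,0\rangle=\sum_{l=0}^{n}\binom{n}{l}^{1/2}(\cos\theta)^l(\sin\theta)^{n-l}\,|l,n-l\rangle .$$ Let $(p_n)_{n\ge 0}$ be a probability distribution with $p_0=0$ (for example that of a photon-added or shifted thermal state), let $\rho_i=\sum_{n}p_n|n\rangle\langle n|$, and let $$\rho=U(\pi/4)\,(\rho_i\otimes|0\rangle\langle 0|)\,U(\pi/4)^\dagger=\sum_{n\ge 1}p_n|\psi_{n,0}\rangle\langle\psi_{n,0}|,\qquad |\psi_{n,0}\rangle=U(\pi/4)|n,0\rangle .$$ Let $\omega\in\mathbb C$ with $0<|\omega|<1$, let $$|0_{sq}\rangle=(1-|\omega|^2)^{1/4}\sum_{k=0}^{\infty}\sqrt{\frac{\Gamma(k+1/2)}{k!\sqrt\pi}}\;\omega^k\,|2k\rangle$$ be the squeezed vacuum, and let $|\Omega\rangle=U(\theta)(|0_{sq}\rangle\otimes|0\rangle)$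 with $0<\theta<\pi/4$. Then for every $\lambda\in[0,1]$ the operator $$\rho'=\lambda\rho+(1-\lambda)|\Omega\rangle\langle\Omega|$$ is an entangled state of the two modes: it is a density operator (positive, of trace one), and it is not separable, that is, it is not a limit in trace norm of finite convex combinations of product states $|a\rangle\langle a|\otimes|b\rangle\langle b|$ with unit vectors $a,b$. -/

import Mathlib

open scoped ENNReal InnerProductSpace

noncomputable section

namespace TwoMode

/-- The Hilbert space `ℓ²(ι, ℂ)` with orthonormal (Fock) basis indexed by `ι`. -/
abbrev Fock (ι : Type) : Type := lp (fun _ : ι => ℂ) 2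

/-- One bosonic mode. -/
abbrev Mode : Type := Fock ℕ

/-- Two bosonic modes: the Hilbert space tensor product of two copies of `Mode`,
realized on its product basis `|i, j⟩`. -/
abbrev BiMode : Type := Fock (ℕ × ℕ)

/-- The Fock basis vector `|i⟩`. -/
def ket {ι : Type} [DecidableEq ι] (i : ι) : Fock ι := lp.single 2 i (1 : ℂ)

theorem ket_apply {ι : Type} [DecidableEq ι] (i j : ι) :
    (ket i : Fock ι) j = if j = i then 1 else 0 := by
  simp [ket, lp.single_apply, Pi.single_apply]

theorem inner_ket {ι : Type} [DecidableEq ι] (i : ι) (f : Fock ι) : ⟪ket i, f⟫_ℂ = f i := by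
  simp [ket, lp.inner_single_left]

theorem norm_ket {ι : Type} [DecidableEq ι] (i : ι) : ‖(ket i : Fock ι)‖ = 1 := by
  simp [ket, lp.norm_single]

theorem inner_ket_ket {ι : Type} [DecidableEq ι] (i j : ι) :
    ⟪(ket i : Fock ι), ket j⟫_ℂ = if i = j then 1 else 0 := by
  rw [inner_ket, ket_apply]

theorem memℓp_tensor (a b : Mode) :
    Memℓp (E := fun _ : ℕ × ℕ => ℂ) (fun x => a x.1 * b x.2) 2 := by
  have h2 : 0 < (2 : ℝ≥0∞).toReal := by norm_num
  refine memℓp_gen ?_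
  have ha := (lp.memℓp a).summable h2
  have hb := (lp.memℓp b).summable h2
  refine (ha.mul_of_nonneg hb (fun i => by positivity) (fun i => by positivity)).congr ?_
  intro x
  rw [norm_mul, Real.mul_rpow (norm_nonneg _) (norm_nonneg _)]

/-- The product vector `|a⟩ ⊗ |b⟩`. -/
def tensor (a b : Mode) : BiMode := ⟨fun x => a x.1 * b x.2, memℓp_tensor a b⟩

/-- `|v⟩⟨v|`. -/
def proj {ι : Type} (v : Fock ι) : Fock ι →L[ℂ] Fock ι := InnerProductSpace.rankOne ℂ v v

/-- A density operator: positive with trace one. -/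
def IsDensity {ι : Type} [DecidableEq ι] (ρ : Fock ι →L[ℂ] Fock ι) : Prop :=
  ρ.IsPositive ∧ HasSum (fun i => ⟪ket i, ρ (ket i)⟫_ℂ) 1

/-- The absolute value `|T| = (T† T)^{1/2}` of a bounded operator on a Hilbert space. -/
def absOp {H : Type} [NormedAddCommGroup H] [InnerProductSpace ℂ H] [CompleteSpace H]
    (T : H →L[ℂ] H) : H →L[ℂ] H := CFC.abs T

/-- The trace norm `tr |T|`, with the value `∞` when `T` is not
trace class. -/
def traceNorm {ι : Type} [DecidableEq ι] (T : Fock ι →L[ℂ] Fock ι) : ℝ≥0∞ :=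
  ∑' i, ENNReal.ofReal (⟪ket i, absOp T (ket i)⟫_ℂ).re

/-- The pure product states `|a, b⟩⟨a, b|`. -/
def pureProductStates : Set (BiMode →L[ℂ] BiMode) :=
  {σ | ∃ a b : Mode, ‖a‖ = 1 ∧ ‖b‖ = 1 ∧ σ = proj (tensor a b)}

/-- Separability: `ρ` can be approximated in trace norm by finite convex combinations of
product states. -/
def IsSeparable (ρ : BiMode →L[ℂ] BiMode) : Prop :=
  ∀ ε : ℝ, 0 < ε → ∃ σ ∈ convexHull ℝ pureProductStates, traceNorm (ρ - σ) < ENNReal.ofReal ε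

/-- An entangled state is a density operator that is not separable. -/
def IsEntangled (ρ : BiMode →L[ℂ] BiMode) : Prop :=
  IsDensity ρ ∧ ¬ IsSeparable ρ

/-- The image `U(θ)|n, 0⟩ = ∑ₗ (n choose l)^{1/2} (cos θ)^l (sin θ)^{n-l} |l, n-l⟩` of the
`n`-photon state under the beam splitter with angle `θ`, the other input port being vacuum. -/
def beamVec (θ : ℝ) (n : ℕ) : BiMode :=
  ∑ l ∈ Finset.range (n + 1),
    ((√(n.choose l : ℝ) * Real.cos θ ^ l * Real.sin θ ^ (n - l) : ℝ) : ℂ) • ket (l, n - l)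

theorem orthonormal_beamVec (θ : ℝ) : Orthonormal ℂ (beamVec θ) := by
  rw [orthonormal_iff_ite]
  intro m n
  simp only [beamVec, sum_inner, inner_sum, inner_smul_left, inner_smul_right, inner_ket_ket,
    Finset.mul_sum]
  split_ifs with h
  · subst h
    have key : ∀ i ∈ Finset.range (m + 1), (∑ x ∈ Finset.range (m + 1),
        ((√(m.choose x : ℝ) * Real.cos θ ^ x * Real.sin θ ^ (m - x) : ℝ) : ℂ) *
        ((starRingEnd ℂ) ((√(m.choose i : ℝ) * Real.cos θ ^ i * Real.sin θ ^ (m - i) : ℝ) : ℂ) *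
          (if (i, m - i) = (x, m - x) then 1 else 0))) =
        (((Real.cos θ ^ 2) ^ i * (Real.sin θ ^ 2) ^ (m - i) * (m.choose i : ℝ) : ℝ) : ℂ) := by
      intro i hi
      rw [Finset.sum_eq_single_of_mem i hi]
      · rw [if_pos rfl, Complex.conj_ofReal, mul_one, ← Complex.ofReal_mul]
        congr 1
        have := Real.mul_self_sqrt (Nat.cast_nonneg (α := ℝ) (m.choose i))
        calc _ = (√(m.choose i : ℝ) * √(m.choose i : ℝ)) *
              (Real.cos θ ^ i * Real.cos θ ^ i) * (Real.sin θ ^ (m - i) * Real.sin θ ^ (m - i)) := by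
              ring
          _ = _ := by rw [this]; ring
      · intro j _ hji
        rw [if_neg (fun h => hji (congrArg Prod.fst h).symm)]
        simp
    have e := add_pow (Real.cos θ ^ 2) (Real.sin θ ^ 2) m
    rw [Real.cos_sq_add_sin_sq, one_pow] at e
    rw [Finset.sum_comm, Finset.sum_congr rfl key, ← Complex.ofReal_sum, ← e, Complex.ofReal_one]
  · refine Finset.sum_eq_zero fun i hi => Finset.sum_eq_zero fun j hj => ?_
    rw [if_neg]
    · simp
    · intro h'
      have h1 := congrArg Prod.fst h'
      have h2 := congrArg Prod.snd h'
      simp only [Finset.mem_range] at hi hj h1 h2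
      omega

/-- The isometry `|f⟩ ↦ U(θ) (|f⟩ ⊗ |0⟩)`: the beam splitter with vacuum in its second
input port. -/
def beamSplitter (θ : ℝ) : Mode →ₗᵢ[ℂ] BiMode :=
  (orthonormal_beamVec θ).orthogonalFamily.linearIsometry

/-- The output `U(θ) (ρ ⊗ |0⟩⟨0|) U(θ)†` of the beam splitter for the single-mode input `ρ`. -/
def beamOutput (θ : ℝ) (ρ : Mode →L[ℂ] Mode) : BiMode →L[ℂ] BiMode :=
  (beamSplitter θ).toContinuousLinearMap ∘L ρ ∘L
    ContinuousLinearMap.adjoint (beamSplitter θ).toContinuousLinearMap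

/-- The single-mode state `∑ₙ pₙ |n⟩⟨n|` with photon number distribution `p`. -/
def photonState (p : ℕ → ℝ) : Mode →L[ℂ] Mode := ∑' n, p n • proj (ket n)

/-- The squeezed vacuum
`(1 - |ω|²)^{1/4} ∑ₖ (Γ(k + 1/2) / (k! √π))^{1/2} ω^k |2k⟩`. -/
def squeezedVacuum (ω : ℂ) : Mode :=
  (((1 - ‖ω‖ ^ 2) ^ (1 / 4 : ℝ) : ℝ) : ℂ) •
    ∑' k : ℕ, (((√(Real.Gamma ((k : ℝ) + 1 / 2) / ((k.factorial : ℝ) * √Real.pi)) : ℝ) : ℂ) *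
      ω ^ k) • ket (2 * k)

/-- The vector `|Ω⟩ = U(θ) (|0_sq⟩ ⊗ |0⟩)`. -/
def omegaVec (θ : ℝ) (ω : ℂ) : BiMode := beamSplitter θ (squeezedVacuum ω)

/-- `ρ' = lam ρ + (1 - lam) |Ω⟩⟨Ω|`, where `ρ` is the 50:50 beam splitter output for the
input `∑ₙ pₙ |n⟩⟨n|`. -/
def mixedState (p : ℕ → ℝ) (lam θ : ℝ) (ω : ℂ) : BiMode →L[ℂ] BiMode :=
  lam • beamOutput (Real.pi / 4) (photonState p) + (1 - lam) • proj (omegaVec θ ω)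

end TwoMode

end

/-!
The proof tests separability on finitely many matrix elements. Trace-norm convergence implies
operator-norm convergence, so a continuous real functional that is nonnegative on all
`|a,b⟩⟨a,b|` is nonnegative on every separable state
(`TwoMode.IsSeparable.nonneg_of_forall_tensor`). The two cases below use different functionals.

For `lam = 1` the state has no weight on `|0,0⟩` but, if `p n ≠ 0`, a nonzero coherence
`p n / 2 ^ n` between `|0,n⟩` and `|n,0⟩`. This contradicts positivity of the partial transpose on
the span of `|0,0⟩` and `|n,n⟩` (`TwoMode.IsSeparable.coherence_nonpos`).

For `lam < 1` the range of the state lies in the closed span of `Ω` and of the `ψₙ`, `n ≥ 1`. With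
the rescaling `v̂(l,m) = √(l! m!) v(l,m)`, each `ψ̂ₙ` is constant on `l + m = n`, while
`Ω̂(l,m) = √n! gₙ cosˡθ sinᵐθ`, where `gₙ` are the amplitudes of the squeezed vacuum, so that
`g₀, g₂, g₄ ≠ 0` and `g₁ = g₃ = 0`. A product vector `a ⊗ b` in that span with `a₀ b₀ ≠ 0` would
have, with `x, α₂, α₃` and `y, β₂, β₃` its rescaled coefficients relative to `a₀` and `b₀`, the
relations
`x = y`, `α₂ - x y = κ`, `x y - β₂ = κ'`, `α₃ = α₂ y = x β₂ = β₃`, `α₃ y - x β₃ = κ''`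
with `κ + κ' ≠ 0` and `κ'' ≠ 0`. All but the last give `(κ + κ') x = 0`, hence `x = y = 0`, against
that one. The quantitative form of this contradiction
(`TwoMode.exists_pos_le_of_product_equations`) provides `δ > 0` and vectors `u_j` orthogonal to the
range of the state with `δ |a₀ b₀|² ≤ ∑ⱼ |⟨u_j, a ⊗ b⟩|²` for all `a, b`. By linearity a separable
state annihilating the `u_j` has no weight on `|0,0⟩`, whereas the vacuum weight here is
`(1 - lam) |Ω₀₀|² > 0`.

That the state is a density operator rests on the binomial series of `(1 - t)^{-1/2}`, which
normalizes the squeezed vacuum.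
-/

open scoped ENNReal InnerProductSpace

noncomputable section

namespace TwoMode

/-! ### Separability and closed convex sets of operators -/

theorem hasSum_norm_sq {ι : Type} (f : Fock ι) : HasSum (fun i => ‖f i‖ ^ 2) (‖f‖ ^ 2) := by
  have h := lp.hasSum_norm (p := 2) (by norm_num) f
  simpa using h

theorem inner_proj {ι : Type} (u v w : Fock ι) : ⟪u, proj v w⟫_ℂ = ⟪v, w⟫_ℂ * ⟪u, v⟫_ℂ := by
  simp [proj]

theorem norm_absOp {H : Type} [NormedAddCommGroup H] [InnerProductSpace ℂ H] [CompleteSpace H]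
    (T : H →L[ℂ] H) : ‖absOp T‖ = ‖T‖ := CFC.norm_abs

theorem exists_isPositive_mul_self_eq_absOp {H : Type} [NormedAddCommGroup H]
    [InnerProductSpace ℂ H] [CompleteSpace H] (T : H →L[ℂ] H) :
    ∃ S : H →L[ℂ] H, S.IsPositive ∧ S * S = absOp T :=
  ⟨CFC.sqrt (absOp T), (ContinuousLinearMap.nonneg_iff_isPositive _).1 (CFC.sqrt_nonneg _),
    CFC.sqrt_mul_sqrt_self _ (CFC.abs_nonneg T)⟩

/-- The operator norm is at most the trace norm: with `S = |T|^{1/2}` one has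
`‖T‖ = ‖S‖² ≤ ∑ᵢ ‖S eᵢ‖² = tr |T|`. -/
theorem ofReal_norm_le_traceNorm {ι : Type} [DecidableEq ι] (T : Fock ι →L[ℂ] Fock ι) :
    ENNReal.ofReal ‖T‖ ≤ traceNorm T := by
  set A := absOp T with hA
  obtain ⟨S, hS0, hSS⟩ := exists_isPositive_mul_self_eq_absOp T
  rw [← hA] at hSS
  have hSa : ∀ f g : Fock ι, ⟪S f, g⟫_ℂ = ⟪f, S g⟫_ℂ := fun f g =>
    hS0.inner_left_eq_inner_right f g
  have hdiag : ∀ i, (⟪ket i, A (ket i)⟫_ℂ).re = ‖S (ket i)‖ ^ 2 := by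
    intro i
    rw [← hSS, mul_apply_eq_comp, ← hSa, inner_self_eq_norm_sq_to_K]
    norm_cast
  by_cases hfin : traceNorm T = ∞
  · simp [hfin]
  have htr : traceNorm T = ∑' i, ENNReal.ofReal (‖S (ket i)‖ ^ 2) := by
    simp only [traceNorm, ← hA, hdiag]
  have hsum : Summable fun i => ‖S (ket i)‖ ^ 2 := by
    have := ENNReal.summable_toReal (htr ▸ hfin)
    simpa [ENNReal.toReal_ofReal] using this
  rw [htr, ← ENNReal.ofReal_tsum_of_nonneg (fun i => by positivity) hsum]
  refine ENNReal.ofReal_le_ofReal ?_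
  set τ := ∑' i, ‖S (ket i)‖ ^ 2 with hτ
  have hτ0 : 0 ≤ τ := tsum_nonneg fun i => by positivity
  have hSle : ‖S‖ ≤ √τ := by
    refine ContinuousLinearMap.opNorm_le_bound _ (Real.sqrt_nonneg _) fun g => ?_
    have h1 : ‖S g‖ ^ 2 ≤ τ * ‖g‖ ^ 2 := by
      refine hasSum_le (fun i => ?_) (hasSum_norm_sq (S g)) (hsum.hasSum.mul_right (‖g‖ ^ 2))
      rw [← inner_ket, ← hSa, ← mul_pow]
      gcongr
      exact norm_inner_le_norm _ _
    calc ‖S g‖ = √(‖S g‖ ^ 2) := (Real.sqrt_sq (norm_nonneg _)).symm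
      _ ≤ √(τ * ‖g‖ ^ 2) := Real.sqrt_le_sqrt h1
      _ = √τ * ‖g‖ := by rw [Real.sqrt_mul hτ0, Real.sqrt_sq (norm_nonneg _)]
  calc ‖T‖ = ‖S * S‖ := by rw [hSS, hA, norm_absOp]
    _ ≤ ‖S‖ * ‖S‖ := norm_mul_le _ _
    _ ≤ √τ * √τ := by gcongr
    _ = τ := Real.mul_self_sqrt hτ0

/-- Trace-norm limits are operator-norm limits, so a separable state lies in every operator-norm
closed convex set containing the pure product states. -/
theorem IsSeparable.mem_of_isClosed_of_convex {ρ : BiMode →L[ℂ] BiMode} (hρ : IsSeparable ρ)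
    {C : Set (BiMode →L[ℂ] BiMode)} (hC : IsClosed C) (hconv : Convex ℝ C)
    (hprod : pureProductStates ⊆ C) : ρ ∈ C := by
  rw [← hC.closure_eq, Metric.mem_closure_iff]
  intro ε hε
  obtain ⟨σ, hσ, hlt⟩ := hρ ε hε
  refine ⟨σ, convexHull_min hprod hconv hσ, ?_⟩
  rw [dist_eq_norm]
  exact (ENNReal.ofReal_lt_ofReal_iff hε).1 ((ofReal_norm_le_traceNorm _).trans_lt hlt)

/-- The functional `T ↦ Re ⟨u, T v⟩`. -/
def reElem {ι : Type} (u v : Fock ι) : (Fock ι →L[ℂ] Fock ι) →L[ℝ] ℝ :=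
  Complex.reCLM ∘L ((innerSL ℂ u).restrictScalars ℝ) ∘L
    ((ContinuousLinearMap.apply ℂ (Fock ι) v).restrictScalars ℝ)

@[simp]
theorem reElem_apply {ι : Type} (u v : Fock ι) (T : Fock ι →L[ℂ] Fock ι) :
    reElem u v T = (⟪u, T v⟫_ℂ).re := rfl

theorem reElem_self_proj {ι : Type} (u v : Fock ι) : reElem u u (proj v) = ‖⟪u, v⟫_ℂ‖ ^ 2 := by
  rw [reElem_apply, inner_proj, ← inner_conj_symm v u, mul_comm, Complex.mul_conj,
    Complex.normSq_eq_norm_sq, Complex.ofReal_re]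

theorem IsSeparable.nonneg_of_forall_tensor {ρ : BiMode →L[ℂ] BiMode} (hρ : IsSeparable ρ)
    (Φ : (BiMode →L[ℂ] BiMode) →L[ℝ] ℝ)
    (hΦ : ∀ a b : Mode, ‖a‖ = 1 → ‖b‖ = 1 → 0 ≤ Φ (proj (tensor a b))) : 0 ≤ Φ ρ := by
  have := hρ.mem_of_isClosed_of_convex (C := Φ ⁻¹' Set.Ici 0) (isClosed_Ici.preimage Φ.continuous)
    ((convex_Ici 0).linear_preimage Φ.toLinearMap) ?_
  · exact this
  · rintro _ ⟨a, b, ha, hb, rfl⟩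
    exact hΦ a b ha hb

theorem inner_ket_tensor (a b : Mode) (l m : ℕ) : ⟪ket (l, m), tensor a b⟫_ℂ = a l * b m :=
  inner_ket _ _

/-! ### The partial transposition criterion on one minor -/

/-- Positivity of the partial transpose on the span of `|0,0⟩` and `|n,n⟩`: if `|0,0⟩` carries no
weight in a separable state, then its coherence between `|0,n⟩` and `|n,0⟩` has no positive real
part. -/
theorem IsSeparable.coherence_nonpos {ρ : BiMode →L[ℂ] BiMode} (hρ : IsSeparable ρ) (n : ℕ)
    (h0 : (⟪ket (0, 0), ρ (ket (0, 0))⟫_ℂ).re = 0) :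
    (⟪ket (0, n), ρ (ket (n, 0))⟫_ℂ).re ≤ 0 := by
  set q := (⟪ket (n, n), ρ (ket (n, n))⟫_ℂ).re
  set z := (⟪ket (0, n), ρ (ket (n, 0))⟫_ℂ).re
  -- On a product vector the coherence has modulus `|a₀b₀| |aₙbₙ|`, so that
  -- `2 t xy ≤ t² x² + y²` gives a family of inequalities linear in the state.
  have key : ∀ t : ℝ, 2 * t * z ≤ q := by
    intro t
    have h := hρ.nonneg_of_forall_tensor
      (t ^ 2 • reElem (ket (0, 0)) (ket (0, 0)) + reElem (ket (n, n)) (ket (n, n))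
        - (2 * t) • reElem (ket (0, n)) (ket (n, 0))) ?_
    · simp only [sub_apply, add_apply, smul_apply, reElem_apply, h0, smul_eq_mul] at h
      simp only [q, z]
      linarith
    · intro a b _ _
      simp only [sub_apply, add_apply, smul_apply, reElem_self_proj, smul_eq_mul, inner_ket_tensor]
      rw [reElem_apply, inner_proj, ← inner_conj_symm, inner_ket_tensor, inner_ket_tensor]
      have h1 : (starRingEnd ℂ (a n * b 0) * (a 0 * b n)).re ≤ ‖a 0 * b 0‖ * ‖a n * b n‖ := by
        refine (Complex.re_le_norm _).trans (le_of_eq ?_)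
        simp only [norm_mul, RCLike.norm_conj]
        ring
      have h2 : (-(starRingEnd ℂ (a n * b 0) * (a 0 * b n))).re
          ≤ ‖a 0 * b 0‖ * ‖a n * b n‖ := by
        refine (Complex.re_le_norm _).trans (le_of_eq ?_)
        simp only [norm_neg, norm_mul, RCLike.norm_conj]
        ring
      rw [Complex.neg_re] at h2
      have h3 := abs_le.2 ⟨by linarith, h1⟩
      have h4 : 2 * t * (starRingEnd ℂ (a n * b 0) * (a 0 * b n)).re
          ≤ 2 * |t| * (‖a 0 * b 0‖ * ‖a n * b n‖) := by
        refine (le_abs_self _).trans ?_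
        rw [abs_mul, abs_mul, abs_two]
        gcongr
      nlinarith [sq_nonneg (|t| * ‖a 0 * b 0‖ - ‖a n * b n‖), sq_abs t]
  by_contra! hz
  have := key ((|q| + 1) / (2 * z))
  have h2 : 2 * ((|q| + 1) / (2 * z)) * z = |q| + 1 := by field_simp
  linarith [le_abs_self q]

/-! ### No product vector is close to the support of the state -/

/-- Bounds on the product-vector equations: with `x, y, α₂, …` the rescaled ratios of Fock
coefficients, the seven quantities cannot all be small. -/
theorem exists_pos_le_of_product_equations {κ κ' κ'' : ℂ} (hK : κ + κ' ≠ 0) (hκ : κ'' ≠ 0) :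
    ∃ ε : ℝ, 0 < ε ∧ ∀ x y α₂ α₃ β₂ β₃ : ℂ,
      ‖x - y‖ ≤ ε → ‖α₂ - x * y - κ‖ ≤ ε → ‖x * y - β₂ - κ'‖ ≤ ε → ‖α₃ - α₂ * y‖ ≤ ε →
      ‖α₂ * y - x * β₂‖ ≤ ε → ‖x * β₂ - β₃‖ ≤ ε → ‖α₃ * y - x * β₃ - κ''‖ ≤ ε → False := by
  have hk : 0 < ‖κ + κ'‖ := norm_pos_iff.2 hK
  have hc : 0 < ‖κ''‖ := norm_pos_iff.2 hκ
  set k := ‖κ + κ'‖ with hkdef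
  set c := ‖κ''‖ with hcdef
  set M := 2 + 8 * (c + 3) / k with hM
  have hM2 : 2 < M := by
    have : 0 < 8 * (c + 3) / k := by positivity
    linarith
  set D := 1 + ‖κ‖ + (M + 1) ^ 2 + 2 * (M + 1) with hD
  set E := D * (M + 1) + 1 + 2 * (M + 1) ^ 2 + 4 * (M + 1) with hE
  have hD0 : 0 < D := by positivity
  have hE0 : 0 < E := by positivity
  refine ⟨min 1 (min (k / 16) (c / (2 * E))), by positivity, ?_⟩
  set ε := min 1 (min (k / 16) (c / (2 * E))) with hε
  have hε0 : 0 < ε := by positivity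
  have hε1 : ε ≤ 1 := min_le_left _ _
  have hεk : ε ≤ k / 16 := (min_le_right _ _).trans (min_le_left _ _)
  have hεE : ε * E < c := by
    have h : ε ≤ c / (2 * E) := (min_le_right _ _).trans (min_le_right _ _)
    have h2 : ε * E ≤ c / (2 * E) * E := by gcongr
    have h3 : c / (2 * E) * E = c / 2 := by field_simp
    linarith
  intro x y α₂ α₃ β₂ β₃ h1 h2 h2' h3 h3' h3'' h4
  set r₁ := x - y with hr₁
  set r₂ := α₂ - x * y - κ with hr₂
  set r₂' := x * y - β₂ - κ' with hr₂'
  set r₃ := α₃ - α₂ * y with hr₃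
  set r₃' := α₂ * y - x * β₂ with hr₃'
  set r₃'' := x * β₂ - β₃ with hr₃''
  set r₄ := α₃ * y - x * β₃ - κ'' with hr₄
  set m := ‖x‖ with hm
  have hm0 : 0 ≤ m := norm_nonneg _
  have hy : ‖y‖ ≤ m + ε := by
    have : y = x - r₁ := by rw [hr₁]; ring
    rw [this]
    exact (norm_sub_le _ _).trans (by gcongr)
  have hy0 : 0 ≤ ‖y‖ := norm_nonneg _
  -- Eliminating `α₂, α₃, β₂, β₃` leaves `(κ + κ') x y = -κ''` and `(κ + κ') x = x y (x - y)`
  -- up to the error terms `e` and `f`.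
  set e := -r₄ - x * (y * (r₂ + r₂')) + x * r₃' + y * r₃ + y * r₃' + x * r₃'' with he
  have idA : κ'' = e - (κ + κ') * (x * y) := by
    simp only [he, hr₂, hr₂', hr₃, hr₃', hr₃'', hr₄]; ring
  set f := r₃' + κ * r₁ + x * (y * r₁) - y * r₂ - x * r₂' with hf
  have idB : (κ + κ') * x = f := by
    simp only [hf, hr₁, hr₂, hr₂', hr₃']; ring
  have hebd : ‖e‖ ≤ ε + m * (‖y‖ * (ε + ε)) + m * ε + ‖y‖ * ε + ‖y‖ * ε + m * ε := by
    refine (norm_add_le_of_le (norm_add_le_of_le (norm_add_le_of_le (norm_add_le_of_le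
      (norm_sub_le_of_le (norm_neg r₄ ▸ h4) ?_) ?_) ?_) ?_) ?_) <;>
    simp only [norm_mul] <;> gcongr
    exact norm_add_le_of_le h2 h2'
  have hfbd : ‖f‖ ≤ ε + ‖κ‖ * ε + m * (‖y‖ * ε) + ‖y‖ * ε + m * ε := by
    refine (norm_sub_le_of_le (norm_sub_le_of_le (norm_add_le_of_le (norm_add_le_of_le
      h3' ?_) ?_) ?_) ?_) <;>
    simp only [norm_mul] <;> gcongr
  have hxx : k * (m * m) ≤ c + ‖e‖ + k * (m * ε) := by
    have : (κ + κ') * (x * x) = -κ'' + e + (κ + κ') * (x * r₁) := by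
      rw [idA, hr₁]; ring
    calc k * (m * m) = ‖(κ + κ') * (x * x)‖ := by simp only [norm_mul, hkdef, hm]
      _ ≤ _ := by
        rw [this]
        refine norm_add_le_of_le (norm_add_le_of_le (norm_neg κ'').le le_rfl) ?_
        simp only [norm_mul]
        gcongr
  have hkm : k * m ≤ ‖f‖ := by rw [← idB, norm_mul]
  have hcm : c ≤ ‖e‖ + k * m * ‖y‖ := by
    calc c = ‖e - (κ + κ') * (x * y)‖ := by rw [← idA]
      _ ≤ _ := by
        refine norm_sub_le_of_le le_rfl ?_
        simp only [norm_mul, hkdef, hm, mul_assoc, le_refl]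
  have he' : ‖e‖ ≤ ε * (1 + 2 * (m * ‖y‖) + 2 * m + 2 * ‖y‖) := by linarith
  have hy1 : ‖y‖ ≤ m + 1 := by linarith
  -- The quadratic equation bounds `x`,
  have hmM : m ≤ M := by
    by_contra! hlt
    have hm2 : 2 < m := hM2.trans hlt
    have e1 : m * ‖y‖ ≤ m * (m + 1) := by gcongr
    have e3 : ‖e‖ ≤ ε * 3 + ε * (2 * (m * m) + 6 * m) := by
      have : 1 + 2 * (m * ‖y‖) + 2 * m + 2 * ‖y‖ ≤ 3 + (2 * (m * m) + 6 * m) := by linarith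
      calc ‖e‖ ≤ ε * (1 + 2 * (m * ‖y‖) + 2 * m + 2 * ‖y‖) := he'
        _ ≤ ε * (3 + (2 * (m * m) + 6 * m)) := by gcongr
        _ = _ := by ring
    have e4 : ε * (2 * (m * m) + 6 * m) ≤ k / 16 * (2 * (m * m) + 6 * m) := by gcongr
    have e5 : k * (m * ε) ≤ k * (m * 1) := by gcongr
    have e6 : k * m * 2 ≤ k * m * m := by gcongr
    have e7 : k * m ≤ 8 * (c + 3) := by linarith
    have e8 : m ≤ 8 * (c + 3) / k := by rw [le_div_iff₀ hk]; linarith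
    linarith
  -- the cubic one then makes it small, against `κ'' ≠ 0`.
  have hyM : ‖y‖ ≤ M + 1 := by linarith
  have hprod : m * ‖y‖ ≤ (M + 1) ^ 2 := by
    rw [sq]
    gcongr
    linarith
  have hfD : ‖f‖ ≤ ε * D := by
    have : ‖κ‖ + m * ‖y‖ + ‖y‖ + m + 1 ≤ D := by rw [hD]; linarith
    calc ‖f‖ ≤ ε * (‖κ‖ + m * ‖y‖ + ‖y‖ + m + 1) := by linarith
      _ ≤ ε * D := by gcongr
  have heE : ‖e‖ ≤ ε * (1 + 2 * (M + 1) ^ 2 + 4 * (M + 1)) := by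
    have : 1 + 2 * (m * ‖y‖) + 2 * m + 2 * ‖y‖ ≤ 1 + 2 * (M + 1) ^ 2 + 4 * (M + 1) := by linarith
    calc ‖e‖ ≤ ε * (1 + 2 * (m * ‖y‖) + 2 * m + 2 * ‖y‖) := he'
      _ ≤ _ := by gcongr
  have hlast : k * m * ‖y‖ ≤ ε * D * (M + 1) := by
    have : k * m ≤ ε * D := hkm.trans hfD
    gcongr
  have : ε * E = ε * D * (M + 1) + ε * (1 + 2 * (M + 1) ^ 2 + 4 * (M + 1)) := by rw [hE]; ring
  linarith

/-- The vector `r |i⟩ - s |j⟩ - z̄ |0,0⟩`, representing the functional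
`v ↦ r vᵢ - s vⱼ - z v₀₀`. -/
def threeTerm (i j : ℕ × ℕ) (r s : ℝ) (z : ℂ) : BiMode :=
  (r : ℂ) • ket i - (s : ℂ) • ket j - (starRingEnd ℂ z) • ket (0, 0)

theorem inner_threeTerm (i j : ℕ × ℕ) (r s : ℝ) (z : ℂ) (v : BiMode) :
    ⟪threeTerm i j r s z, v⟫_ℂ = r * v i - s * v j - z * v (0, 0) := by
  simp [threeTerm, inner_ket, mul_comm z]

/-- Vectors of at most four photons which, for suitable `κ, κ', κ''`, are orthogonal to the range
of the state. On a product vector their overlaps are the product-vector equations of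
`exists_pos_le_of_product_equations`, with `√(l! m!)` as the weight of `|l,m⟩`. -/
def witnessVec (κ κ' κ'' : ℂ) : Fin 7 → BiMode :=
  ![threeTerm (1, 0) (0, 1) 1 1 0,
    threeTerm (2, 0) (1, 1) (√2) 1 κ,
    threeTerm (1, 1) (0, 2) 1 (√2) κ',
    threeTerm (3, 0) (2, 1) (√6) (√2) 0,
    threeTerm (2, 1) (1, 2) (√2) (√2) 0,
    threeTerm (1, 2) (0, 3) (√2) (√6) 0,
    threeTerm (3, 1) (1, 3) (√6) (√6) κ'']

/-- The entanglement witness: on product vectors the weight of `|0,0⟩` is controlled by the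
overlaps with `witnessVec`. -/
theorem exists_pos_mul_le_sum_witnessVec {κ κ' κ'' : ℂ} (hK : κ + κ' ≠ 0) (hκ : κ'' ≠ 0) :
    ∃ δ : ℝ, 0 < δ ∧ ∀ a b : Mode, δ * ‖a 0 * b 0‖ ^ 2 ≤
      ∑ j, ‖⟪witnessVec κ κ' κ'' j, tensor a b⟫_ℂ‖ ^ 2 := by
  obtain ⟨ε, hε, H⟩ := exists_pos_le_of_product_equations hK hκ
  refine ⟨ε ^ 2, by positivity, fun a b => ?_⟩
  by_contra! hlt
  have hne : a 0 * b 0 ≠ 0 := by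
    intro h0
    rw [h0] at hlt
    have : 0 ≤ ∑ j, ‖⟪witnessVec κ κ' κ'' j, tensor a b⟫_ℂ‖ ^ 2 := by positivity
    simp only [norm_zero] at hlt
    linarith
  have hn : 0 < ‖a 0 * b 0‖ := norm_pos_iff.2 hne
  have ha : a 0 ≠ 0 := left_ne_zero_of_mul hne
  have hb : b 0 ≠ 0 := right_ne_zero_of_mul hne
  have hj : ∀ j, ‖⟪witnessVec κ κ' κ'' j, tensor a b⟫_ℂ / (a 0 * b 0)‖ ≤ ε := by
    intro j
    have h := (Finset.single_le_sum (f := fun j => ‖⟪witnessVec κ κ' κ'' j, tensor a b⟫_ℂ‖ ^ 2)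
      (fun i _ => by positivity) (Finset.mem_univ j)).trans hlt.le
    rw [← mul_pow] at h
    rw [norm_div, div_le_iff₀ hn]
    exact (pow_le_pow_iff_left₀ (norm_nonneg _) (by positivity) two_ne_zero).1 h
  refine H (a 1 / a 0) (b 1 / b 0) (√2 * a 2 / a 0) (√6 * a 3 / a 0) (√2 * b 2 / b 0)
    (√6 * b 3 / b 0) ?_ ?_ ?_ ?_ ?_ ?_ ?_
  · convert hj 0 using 2
    simp [witnessVec, inner_threeTerm, tensor]
    field_simp
  · convert hj 1 using 2
    simp [witnessVec, inner_threeTerm, tensor]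
    field_simp
  · convert hj 2 using 2
    simp [witnessVec, inner_threeTerm, tensor]
    field_simp
  · convert hj 3 using 2
    simp [witnessVec, inner_threeTerm, tensor]
    field_simp
  · convert hj 4 using 2
    simp [witnessVec, inner_threeTerm, tensor]
    field_simp
  · convert hj 5 using 2
    simp [witnessVec, inner_threeTerm, tensor]
    field_simp
  · convert hj 6 using 2
    simp [witnessVec, inner_threeTerm, tensor]
    field_simp

/-- A separable state whose range is orthogonal to `witnessVec` has no weight on `|0,0⟩`. -/
theorem IsSeparable.vacuum_nonpos {κ κ' κ'' : ℂ} (hK : κ + κ' ≠ 0) (hκ : κ'' ≠ 0)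
    {ρ : BiMode →L[ℂ] BiMode} (hρ : IsSeparable ρ)
    (h0 : ∀ j, (⟪witnessVec κ κ' κ'' j, ρ (witnessVec κ κ' κ'' j)⟫_ℂ).re = 0) :
    (⟪ket (0, 0), ρ (ket (0, 0))⟫_ℂ).re ≤ 0 := by
  obtain ⟨δ, hδ, H⟩ := exists_pos_mul_le_sum_witnessVec hK hκ
  have h := hρ.nonneg_of_forall_tensor
    ((∑ j, reElem (witnessVec κ κ' κ'' j) (witnessVec κ κ' κ'' j))
      - δ • reElem (ket (0, 0)) (ket (0, 0))) ?_
  · simp only [sub_apply, smul_apply, sum_apply, reElem_apply, h0, Finset.sum_const_zero,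
      smul_eq_mul] at h
    nlinarith
  · intro a b _ _
    simp only [sub_apply, smul_apply, sum_apply, reElem_self_proj, smul_eq_mul, inner_ket_tensor,
      sub_nonneg]
    exact H a b

/-! ### The beam splitter in the Fock basis -/

/-- The amplitude of `|l, m⟩` in `U(θ)|l + m, 0⟩`. -/
def beamCoef (θ : ℝ) (l m : ℕ) : ℝ := √((l + m).choose l : ℝ) * Real.cos θ ^ l * Real.sin θ ^ m

theorem beamVec_apply (θ : ℝ) (n l m : ℕ) :
    beamVec θ n (l, m) = if n = l + m then (beamCoef θ l m : ℂ) else 0 := by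
  rw [← inner_ket, beamVec, inner_sum]
  simp only [inner_smul_right, inner_ket_ket, Prod.mk.injEq]
  split_ifs with h
  · subst h
    rw [Finset.sum_eq_single_of_mem l (by simp)]
    · simp [beamCoef]
    · intro b _ hb
      simp [Ne.symm hb]
  · refine Finset.sum_eq_zero fun b hb => ?_
    rw [if_neg, mul_zero]
    rintro ⟨rfl, rfl⟩
    simp only [Finset.mem_range] at hb
    omega

theorem beamSplitter_ket (θ : ℝ) (n : ℕ) : beamSplitter θ (ket n) = beamVec θ n := by
  rw [beamSplitter, ket, OrthogonalFamily.linearIsometry_apply_single]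
  simp

theorem adjoint_beamSplitter_apply (θ : ℝ) (v : BiMode) (n : ℕ) :
    ContinuousLinearMap.adjoint (beamSplitter θ).toContinuousLinearMap v n =
      ⟪beamVec θ n, v⟫_ℂ := by
  rw [← inner_ket, ContinuousLinearMap.adjoint_inner_right]
  simp [beamSplitter_ket]

theorem adjoint_beamSplitter_ket (θ : ℝ) (l m : ℕ) :
    ContinuousLinearMap.adjoint (beamSplitter θ).toContinuousLinearMap (ket (l, m))
      = (beamCoef θ l m : ℂ) • ket (l + m) := by
  ext n
  rw [adjoint_beamSplitter_apply, ← inner_conj_symm, inner_ket, beamVec_apply]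
  simp only [lp.coeFn_smul, Pi.smul_apply, ket_apply]
  split_ifs <;> simp

theorem beamSplitter_apply (θ : ℝ) (f : Mode) (l m : ℕ) :
    beamSplitter θ f (l, m) = beamCoef θ l m * f (l + m) := by
  have := ContinuousLinearMap.adjoint_inner_left (beamSplitter θ).toContinuousLinearMap
    f (ket (l, m))
  rw [adjoint_beamSplitter_ket, inner_smul_left, inner_ket, inner_ket, Complex.conj_ofReal] at this
  exact this.symm

theorem inner_beamOutput (θ : ℝ) (ρ : Mode →L[ℂ] Mode) (u v : BiMode) :
    ⟪u, beamOutput θ ρ v⟫_ℂ =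
      ⟪ContinuousLinearMap.adjoint (beamSplitter θ).toContinuousLinearMap u,
        ρ (ContinuousLinearMap.adjoint (beamSplitter θ).toContinuousLinearMap v)⟫_ℂ := by
  rw [ContinuousLinearMap.adjoint_inner_left]
  rfl

theorem sum_antidiagonal_beamCoef_sq (θ : ℝ) (n : ℕ) :
    ∑ x ∈ Finset.HasAntidiagonal.antidiagonal n, beamCoef θ x.1 x.2 ^ 2 = 1 := by
  have h := Commute.add_pow' (Commute.all (Real.cos θ ^ 2) (Real.sin θ ^ 2)) n
  rw [Real.cos_sq_add_sin_sq, one_pow] at h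
  rw [h]
  refine Finset.sum_congr rfl fun x hx => ?_
  rw [Finset.HasAntidiagonal.mem_antidiagonal] at hx
  rw [beamCoef, hx, mul_pow, mul_pow, Real.sq_sqrt (Nat.cast_nonneg _), nsmul_eq_mul, ← pow_mul,
    ← pow_mul, ← pow_mul, ← pow_mul, mul_comm x.1, mul_comm x.2, mul_assoc]

theorem beamCoef_pi_div_four (l m : ℕ) :
    beamCoef (Real.pi / 4) l m = √((l + m).choose l : ℝ) * (√2 / 2) ^ (l + m) := by
  rw [beamCoef, Real.cos_pi_div_four, Real.sin_pi_div_four, mul_assoc, pow_add]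

/-! ### The photon-number mixture -/

theorem photonState_apply {p : ℕ → ℝ} (hp : Summable p) (f : Mode) (n : ℕ) :
    photonState p f n = p n * f n := by
  have hs : Summable fun n => p n • proj (ket n : Mode) := by
    refine Summable.of_norm ?_
    simpa [norm_smul, proj, norm_ket] using hp.norm
  have h := ((hs.hasSum.mapL (ContinuousLinearMap.apply ℂ Mode f)).mapL (innerSL ℂ (ket n)))
  have hterm : ∀ m, innerSL ℂ (ket n) (ContinuousLinearMap.apply ℂ Mode f (p m • proj (ket m)))
      = if m = n then (p n : ℂ) * f n else 0 := by
    intro m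
    rw [ContinuousLinearMap.apply_apply, smul_apply, innerSL_apply_apply,
      inner_smul_right_eq_smul, Complex.real_smul, inner_proj, inner_ket, inner_ket, ket_apply]
    by_cases hm : m = n
    · subst hm; simp
    · simp [hm, Ne.symm hm]
  simp only [hterm] at h
  rw [← inner_ket]
  exact h.unique (hasSum_ite_eq n _)

theorem photonState_ket {p : ℕ → ℝ} (hp : Summable p) (n : ℕ) :
    photonState p (ket n) = (p n : ℂ) • ket n := by
  ext m
  rw [photonState_apply hp]
  simp only [lp.coeFn_smul, Pi.smul_apply, ket_apply, smul_eq_mul]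
  split_ifs with h <;> simp [h]

theorem isPositive_photonState {p : ℕ → ℝ} (hp : Summable p) (h0 : ∀ n, 0 ≤ p n) :
    (photonState p).IsPositive := by
  rw [ContinuousLinearMap.isPositive_iff_complex]
  intro f
  have hsum := lp.hasSum_inner (𝕜 := ℂ) (photonState p f) f
  have heq : ∀ n, ⟪photonState p f n, f n⟫_ℂ = ((p n * ‖f n‖ ^ 2 : ℝ) : ℂ) := by
    intro n
    rw [photonState_apply hp]
    simp [mul_left_comm, Complex.mul_conj, Complex.normSq_eq_norm_sq]
  simp only [heq] at hsum
  have hs := Complex.summable_ofReal.1 hsum.summable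
  rw [hsum.unique (Complex.hasSum_ofReal.2 hs.hasSum)]
  refine ⟨by simp, ?_⟩
  simpa using tsum_nonneg fun n => mul_nonneg (h0 n) (by positivity)

theorem inner_ket_beamOutput_photonState {p : ℕ → ℝ} (hp : Summable p) (θ : ℝ) (l m : ℕ) :
    ⟪ket (l, m), beamOutput θ (photonState p) (ket (m, l))⟫_ℂ =
      ((p (l + m) * (beamCoef θ l m * beamCoef θ m l) : ℝ) : ℂ) := by
  rw [inner_beamOutput, adjoint_beamSplitter_ket, adjoint_beamSplitter_ket, map_smul,
    photonState_ket hp, add_comm m l]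
  simp only [inner_smul_left, inner_smul_right, inner_ket_ket, Complex.conj_ofReal, if_true]
  push_cast
  ring

theorem inner_ket_beamOutput_photonState_diag {p : ℕ → ℝ} (hp : Summable p) (θ : ℝ) (l m : ℕ) :
    ⟪ket (l, m), beamOutput θ (photonState p) (ket (l, m))⟫_ℂ =
      ((p (l + m) * beamCoef θ l m ^ 2 : ℝ) : ℂ) := by
  rw [inner_beamOutput, adjoint_beamSplitter_ket, map_smul, photonState_ket hp]
  simp only [inner_smul_left, inner_smul_right, inner_ket_ket, Complex.conj_ofReal, if_true]
  push_cast
  ring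

theorem isDensity_beamOutput_photonState {p : ℕ → ℝ} (h0 : ∀ n, 0 ≤ p n) (hp : HasSum p 1)
    (θ : ℝ) : IsDensity (beamOutput θ (photonState p)) := by
  refine ⟨(isPositive_photonState hp.summable h0).conj_adjoint _, ?_⟩
  have hfib : ∀ n, HasSum
      (fun x : Finset.HasAntidiagonal.antidiagonal n => p n * beamCoef θ x.1.1 x.1.2 ^ 2)
      (p n) := by
    intro n
    have := (hasSum_fintype fun x : Finset.HasAntidiagonal.antidiagonal n =>
      beamCoef θ x.1.1 x.1.2 ^ 2).mul_left
      (p n)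
    rwa [Finset.sum_coe_sort (Finset.HasAntidiagonal.antidiagonal n)
      (fun x => beamCoef θ x.1 x.2 ^ 2),
      sum_antidiagonal_beamCoef_sq, mul_one] at this
  set F : ℕ × ℕ → ℝ := fun x => p (x.1 + x.2) * beamCoef θ x.1 x.2 ^ 2 with hF
  set G : (Σ n : ℕ, Finset.HasAntidiagonal.antidiagonal n) → ℝ := fun x =>
    p x.1 * beamCoef θ x.2.1.1 x.2.1.2 ^ 2
    with hG
  have hG0 : ∀ x, 0 ≤ G x := fun x => mul_nonneg (h0 _) (sq_nonneg _)
  have hGs : Summable G := by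
    rw [summable_sigma_of_nonneg hG0]
    refine ⟨fun n => (hfib n).summable, ?_⟩
    simpa only [hG, (hfib _).tsum_eq] using hp.summable
  have hG1 : HasSum G 1 := by
    have h := hGs.hasSum.sigma fun n => hfib n
    rw [← h.unique hp]
    exact hGs.hasSum
  have hFG : G = F ∘ Finset.HasAntidiagonal.sigmaAntidiagonalEquivProd := by
    funext ⟨n, x, hx⟩
    rw [Finset.HasAntidiagonal.mem_antidiagonal] at hx
    simp [hF, hG, hx]
  rw [hFG, Equiv.hasSum_iff] at hG1
  have := Complex.hasSum_ofReal.2 hG1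
  rw [Complex.ofReal_one] at this
  convert this using 2 with x
  exact inner_ket_beamOutput_photonState_diag hp.summable θ x.1 x.2

/-- With no vacuum component in the input, a vector orthogonal to every output `U(θ)|n, 0⟩`,
`n ≥ 1`, lies in the kernel of the output state. -/
theorem inner_beamOutput_photonState_eq_zero {p : ℕ → ℝ} (hp : Summable p) (h0 : p 0 = 0)
    {θ : ℝ} {u : BiMode} (hu : ∀ n, n ≠ 0 → ⟪u, beamVec θ n⟫_ℂ = 0) :
    ⟪u, beamOutput θ (photonState p) u⟫_ℂ = 0 := by
  rw [inner_beamOutput]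
  have hz : photonState p
      (ContinuousLinearMap.adjoint (beamSplitter θ).toContinuousLinearMap u) = 0 := by
    ext n
    rw [photonState_apply hp, adjoint_beamSplitter_apply]
    rcases eq_or_ne n 0 with rfl | hn
    · simp [h0]
    · rw [← inner_conj_symm, hu n hn]
      simp
  rw [hz, inner_zero_right]

/-! ### The squeezed vacuum -/

/-- The weight `Γ(k + 1/2) / (k! √π)`. -/
def squeezedWeight (k : ℕ) : ℝ := Real.Gamma ((k : ℝ) + 1 / 2) / ((k.factorial : ℝ) * √Real.pi)

theorem squeezedWeight_pos (k : ℕ) : 0 < squeezedWeight k := by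
  have : 0 < Real.Gamma ((k : ℝ) + 1 / 2) := Real.Gamma_pos_of_pos (by positivity)
  have := Real.pi_pos
  unfold squeezedWeight
  positivity

/-- The weights are the binomial coefficients of `(1 - t)^{-1/2}`. -/
theorem squeezedWeight_eq_choose (k : ℕ) :
    squeezedWeight k = Ring.choose ((1 / 2 : ℝ) + k - 1) k := by
  have hasc : ∀ k : ℕ, Real.Gamma ((k : ℝ) + 1 / 2) / √Real.pi =
      (ascPochhammer ℕ k).smeval (1 / 2 : ℝ) := by
    intro k
    induction k with
    | zero =>
      have : √Real.pi ≠ 0 := (Real.sqrt_pos.2 Real.pi_pos).ne'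
      simp [Real.Gamma_one_half_eq, this, -one_div]
    | succ k ih =>
      rw [ascPochhammer_succ_right, Polynomial.smeval_mul, ← ih, Polynomial.smeval_add,
        Polynomial.smeval_X, Polynomial.smeval_natCast]
      have : ((k + 1 : ℕ) : ℝ) + 1 / 2 = ((k : ℝ) + 1 / 2) + 1 := by push_cast; ring
      rw [this, Real.Gamma_add_one (by positivity)]
      simp
      ring
  have h := Ring.factorial_nsmul_multichoose_eq_ascPochhammer (1 / 2 : ℝ) k
  rw [← hasc, nsmul_eq_mul] at h
  have hk : (k.factorial : ℝ) ≠ 0 := by positivity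
  rw [Ring.choose, show (1 / 2 : ℝ) + k - 1 - k + 1 = 1 / 2 by ring, squeezedWeight,
    mul_comm (k.factorial : ℝ), ← div_div, ← h]
  field_simp

theorem hasSum_squeezedWeight_mul_pow {t : ℝ} (ht0 : 0 ≤ t) (ht : t < 1) :
    HasSum (fun k => squeezedWeight k * t ^ k) ((1 - t) ^ (-(1 / 2) : ℝ)) := by
  have h := (Real.one_div_one_sub_rpow_hasFPowerSeriesOnBall_zero (1 / 2)).hasSum (y := t) (by
    rw [Metric.mem_eball, edist_zero_right, ← ofReal_norm, ENNReal.ofReal_lt_one,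
      Real.norm_of_nonneg ht0]
    exact ht)
  simp only [zero_add, FormalMultilinearSeries.ofScalars_apply_eq, smul_eq_mul] at h
  rw [Real.rpow_neg (by linarith), ← one_div]
  simpa only [squeezedWeight_eq_choose] using h

/-- The amplitudes of the unnormalized squeezed vacuum. -/
def squeezedAmp (ω : ℂ) (n : ℕ) : ℂ :=
  if Even n then ((√(squeezedWeight (n / 2)) : ℝ) : ℂ) * ω ^ (n / 2) else 0

theorem squeezedAmp_two_mul (ω : ℂ) (k : ℕ) :
    squeezedAmp ω (2 * k) = ((√(squeezedWeight k) : ℝ) : ℂ) * ω ^ k := by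
  simp [squeezedAmp]

theorem squeezedAmp_eq_zero (ω : ℂ) {n : ℕ} (hn : n ∉ Set.range fun k => 2 * k) :
    squeezedAmp ω n = 0 := by
  rw [squeezedAmp, if_neg]
  rintro ⟨k, hk⟩
  exact hn ⟨k, by simp only; omega⟩

theorem two_mul_injective : Function.Injective fun k : ℕ => 2 * k := fun a b h => by
  simpa using h

theorem hasSum_norm_squeezedAmp_sq {ω : ℂ} (hω : ‖ω‖ < 1) :
    HasSum (fun n => ‖squeezedAmp ω n‖ ^ 2) ((1 - ‖ω‖ ^ 2) ^ (-(1 / 2) : ℝ)) := by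
  rw [← two_mul_injective.hasSum_iff fun n hn => by rw [squeezedAmp_eq_zero ω hn]; simp]
  convert hasSum_squeezedWeight_mul_pow (t := ‖ω‖ ^ 2) (by positivity)
    (by nlinarith [norm_nonneg ω]) using 2 with k
  simp only [Function.comp_apply, squeezedAmp_two_mul, norm_mul, Complex.norm_real, norm_pow]
  rw [mul_pow, Real.norm_eq_abs, sq_abs, Real.sq_sqrt (squeezedWeight_pos k).le, ← pow_mul,
    ← pow_mul, mul_comm k, mul_comm]

theorem memℓp_squeezedAmp {ω : ℂ} (hω : ‖ω‖ < 1) :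
    Memℓp (E := fun _ : ℕ => ℂ) (squeezedAmp ω) 2 := by
  refine memℓp_gen ?_
  simpa using (hasSum_norm_squeezedAmp_sq hω).summable

theorem squeezedVacuum_eq {ω : ℂ} (hω : ‖ω‖ < 1) :
    squeezedVacuum ω = (((1 - ‖ω‖ ^ 2) ^ (1 / 4 : ℝ) : ℝ) : ℂ) •
      (⟨squeezedAmp ω, memℓp_squeezedAmp hω⟩ : Mode) := by
  have h := lp.hasSum_single (p := 2) (by norm_num) (⟨squeezedAmp ω, memℓp_squeezedAmp hω⟩ : Mode)
  rw [← two_mul_injective.hasSum_iff fun n hn => by simp [squeezedAmp_eq_zero ω hn]] at h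
  rw [squeezedVacuum, ← h.tsum_eq]
  congr 1
  refine tsum_congr fun k => ?_
  simp only [Function.comp_apply, squeezedAmp_two_mul, ket, ← lp.single_smul, smul_eq_mul, mul_one,
    squeezedWeight]

theorem squeezedVacuum_apply {ω : ℂ} (hω : ‖ω‖ < 1) (n : ℕ) :
    squeezedVacuum ω n = (((1 - ‖ω‖ ^ 2) ^ (1 / 4 : ℝ) : ℝ) : ℂ) * squeezedAmp ω n := by
  rw [squeezedVacuum_eq hω]
  rfl

theorem norm_squeezedVacuum {ω : ℂ} (hω : ‖ω‖ < 1) : ‖squeezedVacuum ω‖ = 1 := by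
  have ht : 0 < 1 - ‖ω‖ ^ 2 := by nlinarith [norm_nonneg ω]
  have h := (hasSum_norm_squeezedAmp_sq hω).mul_left (((1 - ‖ω‖ ^ 2) ^ (1 / 4 : ℝ)) ^ 2)
  have h2 := hasSum_norm_sq (squeezedVacuum ω)
  simp only [squeezedVacuum_apply hω, norm_mul, mul_pow, Complex.norm_real, Real.norm_eq_abs,
    sq_abs] at h2
  have := h2.unique h
  rw [← Real.rpow_natCast ((1 - ‖ω‖ ^ 2) ^ (1 / 4 : ℝ)), ← Real.rpow_mul ht.le,
    ← Real.rpow_add ht] at this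
  norm_num at this
  exact this.resolve_right (by linarith [norm_nonneg (squeezedVacuum ω)])

theorem squeezedVacuum_two_mul_ne_zero {ω : ℂ} (hω0 : 0 < ‖ω‖) (hω : ‖ω‖ < 1) (k : ℕ) :
    squeezedVacuum ω (2 * k) ≠ 0 := by
  have ht : 0 < 1 - ‖ω‖ ^ 2 := by nlinarith [norm_nonneg ω]
  rw [squeezedVacuum_apply hω, squeezedAmp_two_mul]
  have h1 := (Real.rpow_pos_of_pos ht (1 / 4)).ne'
  have h2 := (Real.sqrt_pos.2 (squeezedWeight_pos k)).ne'
  have h3 : ω ≠ 0 := norm_pos_iff.1 hω0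
  exact mul_ne_zero (Complex.ofReal_ne_zero.2 h1)
    (mul_ne_zero (Complex.ofReal_ne_zero.2 h2) (pow_ne_zero _ h3))

theorem squeezedVacuum_odd {ω : ℂ} (hω : ‖ω‖ < 1) {n : ℕ} (hn : ¬ Even n) :
    squeezedVacuum ω n = 0 := by
  rw [squeezedVacuum_apply hω, squeezedAmp, if_neg hn, mul_zero]

/-! ### The mixed state -/

theorem isDensity_proj {ι : Type} [DecidableEq ι] {v : Fock ι} (hv : ‖v‖ = 1) :
    IsDensity (proj v) := by
  refine ⟨InnerProductSpace.isPositive_rankOne_self v, ?_⟩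
  have h := Complex.hasSum_ofReal.2 (hasSum_norm_sq v)
  rw [hv, one_pow, Complex.ofReal_one] at h
  convert h using 2 with i
  rw [inner_proj, ← inner_conj_symm v, inner_ket, mul_comm, Complex.mul_conj,
    Complex.normSq_eq_norm_sq]

theorem IsDensity.convexCombination {ι : Type} [DecidableEq ι] {ρ σ : Fock ι →L[ℂ] Fock ι}
    (hρ : IsDensity ρ) (hσ : IsDensity σ) {t : ℝ} (h0 : 0 ≤ t) (h1 : t ≤ 1) :
    IsDensity (t • ρ + (1 - t) • σ) := by
  constructor
  · have e1 := hρ.1.smul_of_nonneg (Complex.zero_le_real.2 h0)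
    have e2 := hσ.1.smul_of_nonneg (Complex.zero_le_real.2 (sub_nonneg.2 h1))
    have e : t • ρ + (1 - t) • σ = (t : ℂ) • ρ + ((1 - t : ℝ) : ℂ) • σ := by
      refine ContinuousLinearMap.ext fun f => ?_
      simp only [add_apply, smul_apply, Complex.coe_smul]
      rfl
    rw [e]
    exact e1.add e2
  · have hterm : ∀ i, ⟪ket i, (t • ρ + (1 - t) • σ) (ket i)⟫_ℂ =
        (t : ℂ) * ⟪ket i, ρ (ket i)⟫_ℂ + ((1 - t : ℝ) : ℂ) * ⟪ket i, σ (ket i)⟫_ℂ := by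
      intro i
      rw [add_apply, smul_apply, smul_apply, inner_add_right, inner_smul_right_eq_smul,
        inner_smul_right_eq_smul, Complex.real_smul, Complex.real_smul]
    have hone : (1 : ℂ) = (t : ℂ) * 1 + ((1 - t : ℝ) : ℂ) * 1 := by push_cast; ring
    simp only [hterm]
    rw [hone]
    exact (hρ.2.mul_left (t : ℂ)).add (hσ.2.mul_left ((1 - t : ℝ) : ℂ))

theorem isDensity_mixedState {p : ℕ → ℝ} (h0 : ∀ n, 0 ≤ p n) (hp : HasSum p 1) {t : ℝ}
    (ht0 : 0 ≤ t) (ht1 : t ≤ 1) (θ : ℝ) {ω : ℂ} (hω : ‖ω‖ < 1) :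
    IsDensity (mixedState p t θ ω) :=
  (isDensity_beamOutput_photonState h0 hp _).convexCombination
    (isDensity_proj (by rw [omegaVec, LinearIsometry.norm_map, norm_squeezedVacuum hω])) ht0 ht1

theorem inner_mixedState (p : ℕ → ℝ) (t θ : ℝ) (ω : ℂ) (u v : BiMode) :
    ⟪u, mixedState p t θ ω v⟫_ℂ = t * ⟪u, beamOutput (Real.pi / 4) (photonState p) v⟫_ℂ
      + (1 - t : ℝ) * (⟪omegaVec θ ω, v⟫_ℂ * ⟪u, omegaVec θ ω⟫_ℂ) := by
  simp only [mixedState, add_apply, smul_apply, inner_add_right, inner_smul_right_eq_smul,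
    Complex.real_smul, inner_proj]

/-- The case without `|Ω⟩`: a photon-number mixture without vacuum is entangled after the
balanced beam splitter. -/
theorem not_isSeparable_mixedState_one {p : ℕ → ℝ} (h0 : ∀ n, 0 ≤ p n) (hp : HasSum p 1)
    (hvac : p 0 = 0) (θ : ℝ) (ω : ℂ) : ¬ IsSeparable (mixedState p 1 θ ω) := by
  intro hsep
  obtain ⟨n, hn⟩ : ∃ n, p n ≠ 0 := by
    by_contra! h
    have : p = fun _ => 0 := funext h
    rw [this] at hp
    exact one_ne_zero (hp.unique hasSum_zero)
  have hpos : 0 < p n := lt_of_le_of_ne (h0 n) (Ne.symm hn)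
  have h := hsep.coherence_nonpos n (by
    rw [inner_mixedState, inner_ket_beamOutput_photonState_diag hp.summable]
    simp [hvac])
  rw [inner_mixedState, inner_ket_beamOutput_photonState hp.summable] at h
  simp only [beamCoef_pi_div_four, Complex.ofReal_one, one_mul, sub_self, Complex.ofReal_zero,
    zero_mul, add_zero, Complex.ofReal_re, zero_add, Nat.choose_zero_right, Nat.choose_self,
    Nat.cast_one, Real.sqrt_one] at h
  have : 0 < p n * ((√2 / 2) ^ n * (√2 / 2) ^ n) := by positivity
  linarith

/-- If `|Ω⟩` is present, its vacuum amplitude is nonzero, while `witnessVec` annihilates the whole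
state for the right constants. -/
theorem not_isSeparable_mixedState_of_lt_one {p : ℕ → ℝ} (hp : HasSum p 1)
    (hvac : p 0 = 0) {t : ℝ} (ht : t < 1) {θ : ℝ} (hθ0 : 0 < θ) (hθ1 : θ < Real.pi / 4)
    {ω : ℂ} (hω0 : 0 < ‖ω‖) (hω1 : ‖ω‖ < 1) : ¬ IsSeparable (mixedState p t θ ω) := by
  intro hsep
  set c := Real.cos θ with hc
  set s := Real.sin θ with hs
  have hs0 : 0 < s := Real.sin_pos_of_pos_of_lt_pi hθ0 (by linarith [Real.pi_pos])
  have hcs : s < c := by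
    have h := Real.sin_lt_sin_of_lt_of_le_pi_div_two (x := θ) (y := Real.pi / 2 - θ)
      (by linarith [Real.pi_pos]) (by linarith) (by linarith)
    rwa [Real.sin_pi_div_two_sub] at h
  have hc0 : 0 < c := hs0.trans hcs
  set g : ℕ → ℂ := fun n => squeezedVacuum ω n with hg
  have g0 : g 0 ≠ 0 := squeezedVacuum_two_mul_ne_zero hω0 hω1 0
  have g2 : g 2 ≠ 0 := squeezedVacuum_two_mul_ne_zero hω0 hω1 1
  have g4 : g 4 ≠ 0 := squeezedVacuum_two_mul_ne_zero hω0 hω1 2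
  have g1 : g 1 = 0 := squeezedVacuum_odd hω1 (by decide)
  have g3 : g 3 = 0 := squeezedVacuum_odd hω1 (by decide)
  have hΩ : ∀ l m, omegaVec θ ω (l, m) = ((√((l + m).choose l : ℝ) * c ^ l * s ^ m : ℝ) : ℂ)
      * g (l + m) := fun l m => beamSplitter_apply θ _ l m
  have hψ : ∀ n l m, beamVec (Real.pi / 4) n (l, m) =
      if n = l + m then ((√((l + m).choose l : ℝ) * (√2 / 2) ^ (l + m) : ℝ) : ℂ) else 0 := by
    intro n l m
    rw [beamVec_apply, beamCoef_pi_div_four]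
  set κ : ℂ := √2 * (g 2 / g 0) * (c * (c - s)) with hκ
  set κ' : ℂ := √2 * (g 2 / g 0) * (s * (c - s)) with hκ'
  set κ'' : ℂ := √6 * √4 * (g 4 / g 0) * (c * s * (c ^ 2 - s ^ 2)) with hκ''
  have hK : κ + κ' ≠ 0 := by
    have : κ + κ' = √2 * (g 2 / g 0) * (((c + s) * (c - s) : ℝ) : ℂ) := by
      rw [hκ, hκ']; push_cast; ring
    rw [this]
    refine mul_ne_zero (mul_ne_zero (by simp) (div_ne_zero g2 g0)) (Complex.ofReal_ne_zero.2 ?_)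
    exact mul_ne_zero (by linarith) (by linarith)
  have hK2 : κ'' ≠ 0 := by
    have : κ'' = √6 * √4 * (g 4 / g 0) * ((c * s * ((c + s) * (c - s)) : ℝ) : ℂ) := by
      rw [hκ'']; push_cast; ring
    rw [this]
    refine mul_ne_zero (mul_ne_zero (mul_ne_zero (by simp) (by simp)) (div_ne_zero g4 g0))
      (Complex.ofReal_ne_zero.2 ?_)
    exact mul_ne_zero (by positivity) (mul_ne_zero (by linarith) (by linarith))
  have r6 : (√6 : ℂ) = √2 * √3 := by
    rw [← Complex.ofReal_mul, ← Real.sqrt_mul (by norm_num)]; norm_num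
  -- In every sector of `n ≥ 1` photons the weighted amplitudes `√(l! m!) ⟨l,m|ψₙ⟩` are all equal.
  have hwψ : ∀ j n, n ≠ 0 → ⟪witnessVec κ κ' κ'' j, beamVec (Real.pi / 4) n⟫_ℂ = 0 := by
    intro j n hn
    fin_cases j <;> simp [witnessVec, inner_threeTerm, hψ, hn, r6] <;> split_ifs <;>
      ring
  -- The odd sectors of `Ω` vanish; `κ, κ', κ''` absorb those of two and four photons.
  have hwΩ : ∀ j, ⟪witnessVec κ κ' κ'' j, omegaVec θ ω⟫_ℂ = 0 := by
    intro j
    fin_cases j <;> simp [witnessVec, inner_threeTerm, hΩ, g1, g3, hκ, hκ', hκ''] <;>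
      field_simp <;> ring
  have h := hsep.vacuum_nonpos hK hK2 fun j => by
    rw [inner_mixedState, hwΩ, inner_beamOutput_photonState_eq_zero hp.summable hvac (hwψ j)]
    simp
  rw [inner_mixedState, inner_ket_beamOutput_photonState_diag hp.summable,
    ← inner_conj_symm, inner_ket, mul_comm (starRingEnd ℂ _), Complex.mul_conj,
    ← Complex.ofReal_mul] at h
  have hΩ0 : omegaVec θ ω (0, 0) ≠ 0 := by
    rw [hΩ]; simpa using g0
  have h2 := mul_pos (sub_pos.2 ht) (Complex.normSq_pos.2 hΩ0)
  simp [hvac] at h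
  linarith

end TwoMode

end

theorem mainTheorem1 (p : ℕ → ℝ) (hp_nonneg : ∀ n, 0 ≤ p n) (hp_sum : HasSum p 1)
    (hp_vac : p 0 = 0) (lam : ℝ) (hlam0 : 0 ≤ lam) (hlam1 : lam ≤ 1)
    (θ : ℝ) (hθ0 : 0 < θ) (hθ1 : θ < Real.pi / 4)
    (ω : ℂ) (hω0 : 0 < ‖ω‖) (hω1 : ‖ω‖ < 1) :
    TwoMode.IsEntangled (TwoMode.mixedState p lam θ ω) := by
  refine ⟨TwoMode.isDensity_mixedState hp_nonneg hp_sum hlam0 hlam1 θ hω1, ?_⟩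
  rcases hlam1.lt_or_eq with hlt | rfl
  · exact TwoMode.not_isSeparable_mixedState_of_lt_one hp_sum hp_vac hlt hθ0 hθ1 hω0 hω1
  · exact TwoMode.not_isSeparable_mixedState_one hp_nonneg hp_sum hp_vac θ ω
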